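/- For an integer $d\ge 2$, a $[d]$-tree is a finite rooted tree in which the children of each vertex are linearly ordered from left to right and every vertex has at most $d$ children. Every connected induced subgraph of a $[d]$-tree is itself a $[d]$-tree with the inherited structure (rooted at its vertex closest to the original root). A $[d]$-tree $\mathcal T$ contiguously contains a $[d]$-tree $T$ if some connected induced subgraph of $\mathcal T$ is isomorphic to $T$ as a $[d]$-tree. A contiguous $k$-universal $[d]$-tree is a $[d]$-tree that contiguously contains every $[d]$-tree with $k$ vertices; $N^{\mathrm{con}}_{[d]}(k)$ denotes the minimum number of vertices of such a tree. Define $[d]$-trees $\Lambda_d(k)$, $k\ge 1$, recursively. $\Lambda_d(1)$ is a single vertex. For $2\le k\le d$, the subtrees attached to the root of $\Lambda_d(k)$ are, from left to right, $$\Lambda_d(1),\Lambda_d(2),\dots,\Lambda_d(\lfloor k/2\rfloor-1),\ \Lambda_d(k-1),\ \Lambda_d(\lceil k/2\rceil-1),\Lambda_d(\lceil k/2\rceil-2),\dots,\Lambda_d(1).$$ For $k>d$ they are, from left to right, $$\Lambda_d(k-d),\Lambda_d(k-d+1),\dots,\Lambda_d(k-\lfloor d/2\rfloor-2),\ \Lambda_d(k-1),\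 \Lambda_d(k-\lceil d/2\rceil-1),\Lambda_d(k-\lceil d/2\rceil-2),\dots,\Lambda_d(k-d).$$ (The increasing list before $\Lambda_d(k-1)$ is empty when its last index is smaller than its first, and likewise the decreasing list after it is empty when its first index is smaller than its last.) Let $L_d(k)$ be the number of vertices of $\Lambda_d(k)$, and let $$p_d(x)=1-x-\sum_{i=\lfloor d/2\rfloor+2}^{d}x^i-\sum_{i=\lceil d/2\rceil+1}^{d}x^i .$$ **Corollary 3.4.** For every $d\ge 2$, the polynomial $p_d$ has a smallest positive real root $x_d$; put $\rho_d=1/x_d$. For every fixed $d\ge 2$ and all $k\ge 1$, contiguous $k$-universal $[d]$-trees exist and $$N^{\mathrm{con}}_{[d]}(k)\le L_d(k)=(\rho_d+o(1))^k ,$$ where the $o(1)$ is as $k\to\infty$. Moreover, as $d\to\infty$, $$\rho_d=1+\frac{4\log d}{d}-\frac{4\log\log d}{d}+o\!\left(\frac{\log\log d}{d}\right).$$ -/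

import Mathlib

open Filter Topology Asymptotics

/-- Finite rooted plane trees: a root together with the list, from left to right, of the subtrees
at its children. -/
inductive PlaneTree : Type
  | node (children : List PlaneTree) : PlaneTree

namespace PlaneTree

/-- The subtrees at the children of the root, from left to right. -/
def children : PlaneTree → List PlaneTree
  | node ts => ts

/-- The number of vertices. -/
def numVertices : PlaneTree → ℕ
  | node ts => 1 + (ts.map numVertices).sum

/-- The subtree at the end of the downward path from the root that at each step goes to the child
with the given position (positions are counted from `0`, from left to right), if this path exists.
-/
def subtreeAt : PlaneTree → List ℕ → Option PlaneTree
  | T, [] => some T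
  | T, i :: a => T.children[i]?.bind fun S => S.subtreeAt a

/-- The vertices of a plane tree, each given by the downward path leading to it from the root. -/
def Vertex (T : PlaneTree) : Type :=
  {a : List ℕ // (T.subtreeAt a).isSome}

/-- `T.IsChild u v`: the vertex `v` is a child of the vertex `u`. -/
def IsChild (T : PlaneTree) (u v : T.Vertex) : Prop :=
  ∃ i : ℕ, v.1 = u.1 ++ [i]

/-- `T.IsLeftOf u v`: the vertices `u` and `v` are children of the same vertex, and `u` is to the
left of `v`. -/
def IsLeftOf (T : PlaneTree) (u v : T.Vertex) : Prop :=
  ∃ (a : List ℕ) (i j : ℕ), u.1 = a ++ [i] ∧ v.1 = a ++ [j] ∧ i < j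

/-- The underlying graph: edges join parents and children. -/
def graph (T : PlaneTree) : SimpleGraph T.Vertex :=
  SimpleGraph.fromRel T.IsChild

/-- `S`-trees: the number of children of every vertex is an element of `S ∪ {0}`. -/
def IsSTree (S : Set ℕ) (T : PlaneTree) : Prop :=
  ∀ (a : List ℕ) (U : PlaneTree), T.subtreeAt a = some U → U.children.length ∈ S ∪ {0}

/-- `[d]`-trees, where `[d] = {1, …, d}`. -/
def IsDTree (d : ℕ) (T : PlaneTree) : Prop :=
  T.IsSTree (Set.Icc 1 d)

/-- `U` contiguously contains `T`: some connected induced subgraph of `U`, regarded as a plane tree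
with the parent-child relation and the left-to-right order of siblings inherited from `U`, is
isomorphic to `T`. -/
def ContiguouslyContains (U T : PlaneTree) : Prop :=
  ∃ W : Set U.Vertex, (U.graph.induce W).Connected ∧
    ∃ φ : T.Vertex ≃ W,
      (∀ u v : T.Vertex, T.IsChild u v ↔ U.IsChild (φ u) (φ v)) ∧
      (∀ u v : T.Vertex, T.IsLeftOf u v ↔ U.IsLeftOf (φ u) (φ v))

/-- Contiguous `k`-universal `[d]`-trees. -/
def IsContiguousUniversal (d k : ℕ) (U : PlaneTree) : Prop :=
  U.IsDTree d ∧ ∀ T : PlaneTree, T.IsDTree d → T.numVertices = k → U.ContiguouslyContains T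

/-- The trees `Λ_d(k)` (only `d ≥ 2` and `k ≥ 1` are relevant). Here `List.Ico a b` is the list
`a, a + 1, …, b - 1`, and `(n + 1) / 2` is the ceiling of half of `n`; `attach` only
serves the proof of termination. -/
def lambdaTree (d : ℕ) (k : ℕ) : PlaneTree :=
  if k ≤ 1 then node []
  else if k ≤ d then
    node ((List.Ico 1 (k / 2)).attach.map (fun i => lambdaTree d i.1)
      ++ [lambdaTree d (k - 1)]
      ++ ((List.Ico 1 ((k + 1) / 2)).attach.map (fun i => lambdaTree d i.1)).reverse)
  else
    node ((List.Ico (k - d) (k - d / 2 - 1)).attach.map (fun i => lambdaTree d i.1)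
      ++ [lambdaTree d (k - 1)]
      ++ ((List.Ico (k - d) (k - (d + 1) / 2)).attach.map (fun i => lambdaTree d i.1)).reverse)
termination_by k
decreasing_by
  all_goals first
    | omega
    | (have := List.Ico.mem.1 i.2; omega)

end PlaneTree

/-- The possible numbers of vertices of a contiguous `k`-universal `[d]`-tree. -/
def universalSizes (d k : ℕ) : Set ℕ :=
  {n | ∃ U : PlaneTree, U.IsContiguousUniversal d k ∧ U.numVertices = n}

/-- The minimum number of vertices in a contiguous `k`-universal `[d]`-tree. -/
noncomputable def minUniversal (d k : ℕ) : ℕ :=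
  sInf (universalSizes d k)

/-- `L_d(k)`, the number of vertices of `Λ_d(k)`. -/
def lambdaSize (d k : ℕ) : ℕ :=
  (PlaneTree.lambdaTree d k).numVertices

/-- The polynomial `p_d`. -/
noncomputable def pPoly (d : ℕ) : Polynomial ℝ :=
  1 - Polynomial.X - ∑ i ∈ Finset.Icc (d / 2 + 2) d, Polynomial.X ^ i
    - ∑ i ∈ Finset.Icc ((d + 1) / 2 + 1) d, Polynomial.X ^ i

/-- The set of positive real roots of `p_d`. -/
def positiveRoots (d : ℕ) : Set ℝ :=
  {x | 0 < x ∧ (pPoly d).IsRoot x}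

/-- The smallest positive real root `x_d` of `p_d`. -/
noncomputable def xRoot (d : ℕ) : ℝ :=
  sInf (positiveRoots d)

/-- The number `ρ_d = 1 / x_d`. -/
noncomputable def rho (d : ℕ) : ℝ :=
  1 / xRoot d

/-! ### Root-preserving embeddings -/

namespace PlaneTree

/-! Every `[d]`-tree with at most `k` vertices embeds root to root into `Λ_d(k)`, by strong
induction on `k` (`rootEmb_lambdaTree`). The child sizes have sum at most `k - 1`, and it suffices
to dominate them by a subsequence of the unimodal list of slot sizes (`exists_forall₂_le_slots`):
fill the left slots greedily, put the first child that does not fit in the central slot `k - 1`, and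
the rest fits on the right.

Counting vertices gives a linear recurrence with characteristic function `charSum d = 1 - p_d`,
strictly increasing on `[0, ∞)`; hence `p_d` has one positive root, and `L_d(k)` lies between
constant multiples of `ρ_d ^ k`.

For large `d`, multiplying `charSum d y⁻¹ - 1` by `y - 1` collapses the geometric sums, so `ρ_d` is
governed by `2 y^(-d/2) ≈ (y - 1)²`. Testing `y = 1 + 4 (L - (1 ± η) M) / d`, with `L = log d` and
`M = log L`, gives the expansion (`rho_bounds`). -/

theorem numVertices_node (ts : List PlaneTree) :
    (node ts).numVertices = 1 + (ts.map numVertices).sum := by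
  rw [numVertices]

theorem numVertices_pos (T : PlaneTree) : 1 ≤ T.numVertices := by
  cases T with
  | node ts => rw [numVertices_node]; omega

theorem subtreeAt_nil (T : PlaneTree) : T.subtreeAt [] = some T := by
  rw [subtreeAt]

theorem subtreeAt_cons (T : PlaneTree) (i : ℕ) (a : List ℕ) :
    T.subtreeAt (i :: a) = T.children[i]?.bind fun S => S.subtreeAt a := by
  rw [subtreeAt]

theorem subtreeAt_append (T : PlaneTree) (a b : List ℕ) :
    T.subtreeAt (a ++ b) = (T.subtreeAt a).bind fun S => S.subtreeAt b := by
  induction a generalizing T with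
  | nil => simp [subtreeAt_nil]
  | cons i a ih =>
    rw [List.cons_append, subtreeAt_cons, subtreeAt_cons, Option.bind_assoc]
    simp only [ih]

theorem isSome_subtreeAt_of_append {T : PlaneTree} {a b : List ℕ}
    (h : (T.subtreeAt (a ++ b)).isSome) : (T.subtreeAt a).isSome := by
  rw [subtreeAt_append] at h
  cases hT : T.subtreeAt a <;> simp_all

/-- `T` embeds into `U` preserving roots, parents and the order of siblings; the embedding is given
as a map on downward paths. -/
def RootEmb (T U : PlaneTree) : Prop :=
  ∃ f : List ℕ → List ℕ, f [] = [] ∧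
    (∀ a, (T.subtreeAt a).isSome → (U.subtreeAt (f a)).isSome) ∧
    ∀ a, ∃ h : ℕ → ℕ, StrictMono h ∧ ∀ i, f (a ++ [i]) = f a ++ [h i]

theorem RootEmb.node {ts us : List PlaneTree} (h : List.SublistForall₂ RootEmb ts us) :
    RootEmb (node ts) (node us) := by
  obtain ⟨l, hl, hsub⟩ := List.sublistForall₂_iff.1 h
  obtain ⟨g, hg⟩ := List.sublist_iff_exists_orderEmbedding_getElem?_eq.1 hsub
  obtain ⟨hlen, hl⟩ := List.forall₂_iff_get.1 hl
  have key : ∀ i, ∃ f : List ℕ → List ℕ, f [] = [] ∧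
      (∀ a, ((PlaneTree.node ts).subtreeAt (i :: a)).isSome →
        ((PlaneTree.node us).subtreeAt (g i :: f a)).isSome) ∧
      ∀ a, ∃ h : ℕ → ℕ, StrictMono h ∧ ∀ i, f (a ++ [i]) = f a ++ [h i] := by
    intro i
    by_cases hi : i < ts.length
    · obtain ⟨f, h0, h1, h2⟩ := hl i hi (hlen ▸ hi)
      refine ⟨f, h0, fun a ha => ?_, h2⟩
      rw [subtreeAt_cons] at ha ⊢
      simp only [children] at ha ⊢
      rw [← hg i, List.getElem?_eq_getElem (hlen ▸ hi)]
      rw [List.getElem?_eq_getElem hi] at ha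
      exact h1 a ha
    -- The last clause of `RootEmb` ranges over all paths, existing or not, so absent children need
    -- a default map.
    · refine ⟨id, rfl, fun a ha => ?_, fun a => ⟨id, strictMono_id, fun i => rfl⟩⟩
      rw [subtreeAt_cons] at ha
      simp only [children] at ha
      rw [List.getElem?_eq_none (by omega)] at ha
      simp at ha
  choose F h0 h1 h2 using key
  refine ⟨fun a => match a with
    | [] => []
    | i :: a => g i :: F i a, rfl, fun a ha => ?_, fun a => ?_⟩
  · cases a with
    | nil => simp [subtreeAt_nil]
    | cons i a => exact h1 i a ha
  · cases a with
    | nil => exact ⟨g, g.strictMono, fun i => by simp [h0]⟩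
    | cons i a =>
      obtain ⟨h, hh, hF⟩ := h2 i a
      exact ⟨h, hh, fun j => by simp [hF]⟩

/-- Comparing paths by their last step makes the path map injective. Its image is connected because
every image vertex is joined to the image of the root. -/
theorem RootEmb.contiguouslyContains {T U : PlaneTree} (h : RootEmb T U) :
    U.ContiguouslyContains T := by
  obtain ⟨f, h0, h1, h2⟩ := h
  have hinj : Function.Injective f := by
    intro a
    induction a using List.reverseRecOn with
    | nil =>
      intro b hb
      rcases List.eq_nil_or_concat' b with rfl | ⟨b, i, rfl⟩
      · rfl
      · obtain ⟨h, -, hf⟩ := h2 b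
        simp [h0, hf] at hb
    | append_singleton a i ih =>
      intro b hb
      obtain ⟨h, hh, hf⟩ := h2 a
      rcases List.eq_nil_or_concat' b with rfl | ⟨b, j, rfl⟩
      · simp [h0, hf] at hb
      · obtain ⟨h', -, hf'⟩ := h2 b
        have hab : a = b := by
          apply ih
          rw [hf, hf'] at hb
          exact (List.append_inj' hb rfl).1
        subst hab
        rw [hf, hf] at hb
        have := hh.injective (by simpa using hb)
        rw [this]
  have hlast : ∀ a b i, f a = b ++ [i] → ∃ c j, a = c ++ [j] ∧ f c = b := by
    intro a b i hab
    rcases List.eq_nil_or_concat' a with rfl | ⟨a, j, rfl⟩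
    · simp [h0] at hab
    · obtain ⟨h, -, hf⟩ := h2 a
      refine ⟨a, j, rfl, ?_⟩
      rw [hf] at hab
      exact (List.append_inj' hab rfl).1
  let F : T.Vertex → U.Vertex := fun u => ⟨f u.1, h1 _ u.2⟩
  have hF : Function.Injective F := fun u v huv =>
    Subtype.ext (hinj (congrArg Subtype.val huv))
  refine ⟨Set.range F, ?_, Equiv.ofInjective F hF, fun u v => ?_, fun u v => ?_⟩
  · let r : T.Vertex := ⟨[], by simp [subtreeAt_nil]⟩
    have hreach : ∀ (a : List ℕ) (ha : (T.subtreeAt a).isSome),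
        (U.graph.induce (Set.range F)).Reachable ⟨F r, r, rfl⟩ ⟨F ⟨a, ha⟩, _, rfl⟩ := by
      intro a
      induction a using List.reverseRecOn with
      | nil => intro ha; exact SimpleGraph.Reachable.refl _
      | append_singleton a i ih =>
        intro ha
        refine (ih (isSome_subtreeAt_of_append ha)).trans (SimpleGraph.Adj.reachable ?_)
        obtain ⟨h, -, hf⟩ := h2 a
        simp only [SimpleGraph.comap_adj, Function.Embedding.subtype_apply, graph,
          SimpleGraph.fromRel_adj]
        refine ⟨fun heq => ?_, Or.inl ⟨h i, hf i⟩⟩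
        have := congrArg Subtype.val (hF heq)
        simp at this
    have : Nonempty (Set.range F) := ⟨⟨F r, r, rfl⟩⟩
    refine ⟨fun x y => ?_⟩
    obtain ⟨_, u, rfl⟩ := x
    obtain ⟨_, v, rfl⟩ := y
    exact (hreach u.1 u.2).symm.trans (hreach v.1 v.2)
  · constructor
    · rintro ⟨i, hi⟩
      obtain ⟨h, -, hf⟩ := h2 u.1
      exact ⟨h i, show f v.1 = f u.1 ++ [h i] by rw [hi, hf]⟩
    · rintro ⟨i, hi⟩
      obtain ⟨c, j, hc, hfc⟩ := hlast v.1 (f u.1) i hi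
      exact ⟨j, by rw [hc, hinj hfc]⟩
  · constructor
    · rintro ⟨a, i, j, hu, hv, hij⟩
      obtain ⟨h, hh, hf⟩ := h2 a
      exact ⟨f a, h i, h j, show f u.1 = _ by rw [hu, hf], show f v.1 = _ by rw [hv, hf], hh hij⟩
    · rintro ⟨b, i, j, hu, hv, hij⟩
      change f u.1 = _ at hu
      change f v.1 = _ at hv
      obtain ⟨c, i', hc, hfc⟩ := hlast _ _ _ hu
      obtain ⟨c', j', hc', hfc'⟩ := hlast _ _ _ hv
      obtain rfl : c = c' := hinj (hfc.trans hfc'.symm)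
      obtain ⟨h, hh, hf⟩ := h2 c
      refine ⟨c, i', j', hc, hc', hh.lt_iff_lt.1 ?_⟩
      rw [hc, hf, hfc] at hu
      rw [hc', hf, hfc] at hv
      simp only [List.append_cancel_left_eq, List.cons.injEq, and_true] at hu hv
      omega

/-! ### Universality of the trees `Λ_d(k)` -/

/-- The unimodal list `q, q + 1, …, q + n - 1, …, q + 1, q` of length `n`. -/
def slots (q n : ℕ) : List ℕ :=
  List.range' q ((n + 1) / 2 - 1) ++ [q + n - 1] ++ (List.range' q (n / 2)).reverse

theorem length_slots (q n : ℕ) (hn : 1 ≤ n) : (slots q n).length = n := by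
  simp [slots]; omega

theorem lambdaTree_of_le_one {d k : ℕ} (hk : k ≤ 1) : lambdaTree d k = node [] := by
  rw [lambdaTree, if_pos hk]

/-- Both branches of the definition become one: `q = 1` when `k ≤ d` and `q = k - d` otherwise,
always with `q + n = k`. -/
theorem lambdaTree_eq {d k : ℕ} (hd : 2 ≤ d) (hk : 2 ≤ k) :
    lambdaTree d k =
      node ((slots (k - min d (k - 1)) (min d (k - 1))).map (lambdaTree d)) := by
  rw [lambdaTree, if_neg (by omega)]
  split_ifs with hkd
  · have h1 : k - min d (k - 1) = 1 := by omega
    have h2 : (min d (k - 1) + 1) / 2 - 1 = k / 2 - 1 := by omega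
    have h3 : 1 + min d (k - 1) - 1 = k - 1 := by omega
    have h4 : min d (k - 1) / 2 = (k + 1) / 2 - 1 := by omega
    simp only [slots, h1, h2, h3, h4, List.attach_map_val, List.map_append, List.map_reverse,
      List.Ico, List.map_cons, List.map_nil]
  · have h1 : min d (k - 1) = d := by omega
    have h2 : k - d / 2 - 1 - (k - d) = (d + 1) / 2 - 1 := by omega
    have h3 : k - d + d - 1 = k - 1 := by omega
    have h4 : k - (d + 1) / 2 - (k - d) = d / 2 := by omega
    simp only [slots, h1, h2, h3, h4, List.attach_map_val, List.map_append, List.map_reverse,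
      List.Ico, List.map_cons, List.map_nil]

theorem isDTree_node {d : ℕ} {ts : List PlaneTree} (hlen : ts.length ≤ d)
    (h : ∀ t ∈ ts, t.IsDTree d) : (node ts).IsDTree d := by
  intro a U hU
  cases a with
  | nil =>
    rw [subtreeAt_nil, Option.some_inj] at hU
    subst hU
    simp only [children, Set.union_singleton, Set.mem_insert_iff, Set.mem_Icc]
    omega
  | cons i a =>
    rw [subtreeAt_cons, Option.bind_eq_some_iff] at hU
    obtain ⟨S, hS, hU⟩ := hU
    exact h S (List.mem_of_getElem? hS) a U hU

theorem IsDTree.length_le {d : ℕ} {ts : List PlaneTree} (h : (node ts).IsDTree d) :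
    ts.length ≤ d := by
  have := h [] _ (subtreeAt_nil _)
  simp only [children, Set.union_singleton, Set.mem_insert_iff, Set.mem_Icc] at this
  omega

theorem IsDTree.of_mem {d : ℕ} {ts : List PlaneTree} (h : (node ts).IsDTree d) {t : PlaneTree}
    (ht : t ∈ ts) : t.IsDTree d := by
  obtain ⟨i, hi⟩ := List.mem_iff_getElem?.1 ht
  intro a U hU
  refine h (i :: a) U ?_
  rw [subtreeAt_cons]
  simp only [children, hi]
  exact hU

theorem mem_slots_lt {q n k i : ℕ} (hq : 1 ≤ q) (hn : 1 ≤ n) (hk : q + n = k)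
    (hi : i ∈ slots q n) : 1 ≤ i ∧ i < k := by
  simp only [slots, List.mem_append, List.mem_reverse, List.mem_range'_1, List.mem_singleton] at hi
  omega

theorem isDTree_lambdaTree {d : ℕ} (hd : 2 ≤ d) (k : ℕ) : (lambdaTree d k).IsDTree d := by
  induction k using Nat.strong_induction_on with
  | _ k ih =>
    by_cases hk : k ≤ 1
    · rw [lambdaTree_of_le_one hk]
      exact isDTree_node (by simp) (by simp)
    · rw [lambdaTree_eq hd (by omega)]
      refine isDTree_node ?_ ?_
      · rw [List.length_map, length_slots _ _ (by omega)]
        exact min_le_left _ _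
      · intro t ht
        obtain ⟨i, hi, rfl⟩ := List.mem_map.1 ht
        exact ih i (mem_slots_lt (k := k) (by omega) (by omega) (by omega) hi).2

/-- The last entry takes the largest slot. Being at least `1`, it pays for the loss of that slot in
the sum condition. -/
theorem exists_forall₂_le_range' (q a : ℕ) :
    ∀ l : List ℕ, (∀ x ∈ l, 1 ≤ x) → l.length ≤ a → l.sum + 1 ≤ a + q →
      ∃ l', List.Forall₂ (· ≤ ·) l l' ∧ l'.Sublist (List.range' q a) := by
  induction a with
  | zero =>
    intro l _ hl _
    have : l = [] := List.length_eq_zero_iff.1 (by omega)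
    exact ⟨[], by simp [this], by simp⟩
  | succ a ih =>
    intro l hpos hlen hsum
    rcases List.eq_nil_or_concat' l with rfl | ⟨l, x, rfl⟩
    · exact ⟨[], by simp, by simp⟩
    · simp only [List.mem_append, List.mem_singleton, List.length_append, List.length_singleton,
        List.sum_append, List.sum_singleton] at hpos hlen hsum
      have hx := hpos x (Or.inr rfl)
      obtain ⟨l', h1, h2⟩ := ih l (fun y hy => hpos y (Or.inl hy)) (by omega) (by omega)
      refine ⟨l' ++ [q + a], List.rel_append h1 (by simp; omega), ?_⟩
      rw [List.range'_1_concat]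
      exact h2.append (List.Sublist.refl _)

theorem length_le_sum {l : List ℕ} (h : ∀ x ∈ l, 1 ≤ x) : l.length ≤ l.sum := by
  simpa using List.card_nsmul_le_sum l 1 h

/-- The longest prefix of `s` fitting into `A` slots with total size less than `A + q`. -/
theorem exists_split (A q : ℕ) (hq : 1 ≤ q) (s : List ℕ) :
    (s.length ≤ A ∧ s.sum + 1 ≤ A + q) ∨ ∃ l c r, s = l ++ [c] ++ r ∧ l.length ≤ A ∧
      l.sum + 1 ≤ A + q ∧ (A < l.length + 1 ∨ A + q < l.sum + c + 1) := by
  induction s using List.reverseRecOn with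
  | nil => left; simp; omega
  | append_singleton s x ih =>
    rcases ih with ⟨h1, h2⟩ | ⟨l, c, r, rfl, h⟩
    · by_cases hx : (s ++ [x]).length ≤ A ∧ (s ++ [x]).sum + 1 ≤ A + q
      · exact Or.inl hx
      · refine Or.inr ⟨s, x, [], by simp, h1, h2, ?_⟩
        simp at hx
        omega
    · exact Or.inr ⟨l, c, r ++ [x], by simp, h⟩

theorem exists_forall₂_le_slots {q n : ℕ} (hq : 1 ≤ q) (hn : 1 ≤ n) (s : List ℕ) (hpos : ∀ x ∈ s, 1 ≤ x)
    (hlen : s.length ≤ n) (hsum : s.sum + 1 ≤ q + n) :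
    ∃ s', List.Forall₂ (· ≤ ·) s s' ∧ s'.Sublist (slots q n) := by
  rcases exists_split ((n + 1) / 2 - 1) q hq s with ⟨h1, h2⟩ | ⟨l, c, r, rfl, h1, h2, h3⟩
  · obtain ⟨l', hl, hl'⟩ := exists_forall₂_le_range' q _ s hpos h1 h2
    refine ⟨l', hl, hl'.trans ?_⟩
    rw [slots, List.append_assoc]
    exact List.sublist_append_left _ _
  · simp only [List.mem_append, List.mem_singleton, List.length_append, List.length_singleton,
      List.sum_append, List.sum_singleton] at hpos hlen hsum
    have hr := length_le_sum (l := r) fun x hx => hpos x (Or.inr hx)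
    have hl := length_le_sum (l := l) fun x hx => hpos x (Or.inl (Or.inl hx))
    have hc := hpos c (Or.inl (Or.inr rfl))
    obtain ⟨l', hl, hl'⟩ := exists_forall₂_le_range' q _ l
      (fun x hx => hpos x (Or.inl (Or.inl hx))) h1 h2
    -- If `l` fills all left slots, then `l` and `c` use up enough of both length and sum. Otherwise
    -- `l.sum + c` is at least `A + q`, with `A` the number of left slots, which leaves `r` a sum,
    -- hence a length, of at most `n / 2`.
    obtain ⟨r', hr, hr'⟩ := exists_forall₂_le_range' q (n / 2) r.reverse
      (fun x hx => hpos x (Or.inr (List.mem_reverse.1 hx)))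
      (by rw [List.length_reverse]; omega) (by rw [List.sum_reverse]; omega)
    refine ⟨l' ++ [q + n - 1] ++ r'.reverse,
      List.rel_append (List.rel_append hl (by simp; omega)) ?_,
      (hl'.append (List.Sublist.refl _)).append hr'.reverse⟩
    rw [← List.forall₂_reverse_iff, List.reverse_reverse]
    exact hr

/-- Sizes up to `k` are allowed because a child may be smaller than its slot. -/
theorem rootEmb_lambdaTree {d : ℕ} (hd : 2 ≤ d) (k : ℕ) :
    ∀ T : PlaneTree, T.IsDTree d → T.numVertices ≤ k → RootEmb T (lambdaTree d k) := by
  induction k using Nat.strong_induction_on with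
  | _ k ih =>
    rintro ⟨ts⟩ hT hk
    rw [numVertices_node] at hk
    have hpos : ∀ x ∈ ts.map numVertices, 1 ≤ x := by
      intro x hx
      obtain ⟨t, -, rfl⟩ := List.mem_map.1 hx
      exact t.numVertices_pos
    have hlen := length_le_sum hpos
    rw [List.length_map] at hlen
    by_cases hk1 : k ≤ 1
    · have : ts = [] := List.length_eq_zero_iff.1 (by omega)
      rw [lambdaTree_of_le_one hk1, this]
      exact RootEmb.node .nil
    · rw [lambdaTree_eq hd (by omega)]
      have hd' := hT.length_le
      obtain ⟨s, hs, hsub⟩ := exists_forall₂_le_slots (q := k - min d (k - 1)) (n := min d (k - 1))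
        (by omega) (by omega) _ hpos (by rw [List.length_map]; omega) (by omega)
      refine RootEmb.node (List.sublistForall₂_iff.2 ⟨s.map (lambdaTree d), ?_, hsub.map _⟩)
      rw [List.forall₂_map_right_iff]
      rw [List.forall₂_map_left_iff] at hs
      rw [List.forall₂_iff_get] at hs ⊢
      refine ⟨hs.1, fun i h1 h2 => ?_⟩
      refine ih _ ?_ _ (hT.of_mem (List.get_mem _ _)) (hs.2 i h1 h2)
      exact (mem_slots_lt (k := k) (by omega) (by omega) (by omega)
        (hsub.subset (List.get_mem s ⟨i, h2⟩))).2

theorem isContiguousUniversal_lambdaTree {d : ℕ} (hd : 2 ≤ d) (k : ℕ) :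
    IsContiguousUniversal d k (lambdaTree d k) :=
  ⟨isDTree_lambdaTree hd k, fun T hT hk =>
    (rootEmb_lambdaTree hd k T hT hk.le).contiguouslyContains⟩

end PlaneTree

theorem lambdaSize_mem_universalSizes {d : ℕ} (hd : 2 ≤ d) (k : ℕ) :
    lambdaSize d k ∈ universalSizes d k :=
  ⟨_, PlaneTree.isContiguousUniversal_lambdaTree hd k, rfl⟩

theorem isLeast_minUniversal {d : ℕ} (hd : 2 ≤ d) (k : ℕ) :
    IsLeast (universalSizes d k) (minUniversal d k) :=
  ⟨Nat.sInf_mem ⟨_, lambdaSize_mem_universalSizes hd k⟩, fun _ h => Nat.sInf_le h⟩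

/-! ### Size recurrence and characteristic root -/

theorem sum_map_range'_eq_sum_Icc {R : Type*} [AddCommMonoid R] (f : ℕ → R) {d k : ℕ}
    (hk : d < k) (n : ℕ) :
    ∀ m, m + n = d + 1 →
      ((List.range' (k - d) n).map f).sum = ∑ i ∈ Finset.Icc m d, f (k - i) := by
  induction n with
  | zero => intro m hm; rw [Finset.Icc_eq_empty (by omega)]; simp
  | succ n ih =>
    intro m hm
    rw [List.range'_1_concat, List.map_append, List.sum_append, ih (m + 1) (by omega),
      ← Finset.insert_Icc_add_one_left_eq_Icc (show m ≤ d by omega),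
      Finset.sum_insert (by simp), add_comm, List.map_singleton, List.sum_singleton]
    congr 2
    omega

theorem lambdaSize_eq {d k : ℕ} (hd : 2 ≤ d) (hk : d < k) :
    lambdaSize d k = 1 + (lambdaSize d (k - 1) +
      ∑ i ∈ Finset.Icc (d / 2 + 2) d, lambdaSize d (k - i) +
      ∑ i ∈ Finset.Icc ((d + 1) / 2 + 1) d, lambdaSize d (k - i)) := by
  have hmin : min d (k - 1) = d := by omega
  have hc : k - d + d - 1 = k - 1 := by omega
  rw [← sum_map_range'_eq_sum_Icc _ hk ((d + 1) / 2 - 1) _ (by omega),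
    ← sum_map_range'_eq_sum_Icc _ hk (d / 2) _ (by omega), lambdaSize,
    PlaneTree.lambdaTree_eq hd (by omega), PlaneTree.numVertices_node, hmin, PlaneTree.slots, hc]
  simp only [List.map_map, List.map_append, List.map_reverse, List.sum_append, List.sum_reverse,
    List.map_cons, List.map_nil, List.sum_singleton]
  have : PlaneTree.numVertices ∘ PlaneTree.lambdaTree d = lambdaSize d := rfl
  rw [this]
  unfold lambdaSize
  ring

theorem one_le_lambdaSize (d k : ℕ) : 1 ≤ lambdaSize d k :=
  PlaneTree.numVertices_pos _

/-- The function `1 - p_d`. -/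
noncomputable def charSum (d : ℕ) (x : ℝ) : ℝ :=
  x + ∑ i ∈ Finset.Icc (d / 2 + 2) d, x ^ i + ∑ i ∈ Finset.Icc ((d + 1) / 2 + 1) d, x ^ i

theorem eval_pPoly (d : ℕ) (x : ℝ) : (pPoly d).eval x = 1 - charSum d x := by
  simp only [pPoly, charSum, Polynomial.eval_sub, Polynomial.eval_one, Polynomial.eval_X,
    Polynomial.eval_finsetSum, Polynomial.eval_pow]
  ring

theorem mem_positiveRoots {d : ℕ} {x : ℝ} : x ∈ positiveRoots d ↔ 0 < x ∧ charSum d x = 1 := by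
  rw [positiveRoots, Set.mem_ofPred_eq, Polynomial.IsRoot, eval_pPoly, sub_eq_zero, eq_comm (a := 1)]

theorem charSum_strictMonoOn (d : ℕ) : StrictMonoOn (charSum d) (Set.Ici 0) := by
  intro x hx y _ hxy
  have hx : 0 ≤ x := hx
  have h (s : Finset ℕ) : ∑ i ∈ s, x ^ i ≤ ∑ i ∈ s, y ^ i :=
    Finset.sum_le_sum fun i _ => pow_le_pow_left₀ hx hxy.le i
  exact add_lt_add_of_lt_of_le (add_lt_add_of_lt_of_le hxy (h _)) (h _)

theorem continuous_charSum (d : ℕ) : Continuous (charSum d) := by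
  unfold charSum
  fun_prop

theorem charSum_zero (d : ℕ) : charSum d 0 = 0 := by
  rw [charSum, Finset.sum_eq_zero, Finset.sum_eq_zero]
  · simp
  all_goals
    intro i hi
    rw [Finset.mem_Icc] at hi
    exact zero_pow (by omega)

theorem one_lt_charSum_one {d : ℕ} (hd : 2 ≤ d) : 1 < charSum d 1 := by
  have h : 1 ≤ d + 1 - ((d + 1) / 2 + 1) := by omega
  have h' : (1 : ℝ) ≤ (d + 1 - ((d + 1) / 2 + 1) : ℕ) := by exact_mod_cast h
  have h0 : (0 : ℝ) ≤ (d + 1 - (d / 2 + 2) : ℕ) := Nat.cast_nonneg _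
  simp only [charSum, one_pow, Finset.sum_const, Nat.card_Icc, nsmul_eq_mul, mul_one]
  linarith

theorem isLeast_xRoot {d : ℕ} (hd : 2 ≤ d) : IsLeast (positiveRoots d) (xRoot d) := by
  obtain ⟨x, hx, hx1⟩ := intermediate_value_Ioo zero_le_one (continuous_charSum d).continuousOn
    (show (1 : ℝ) ∈ Set.Ioo (charSum d 0) (charSum d 1) from
      ⟨by rw [charSum_zero]; exact one_pos, one_lt_charSum_one hd⟩)
  have h : IsLeast (positiveRoots d) x := by
    refine ⟨mem_positiveRoots.2 ⟨hx.1, hx1⟩, fun y hy => ?_⟩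
    obtain ⟨hy, hy1⟩ := mem_positiveRoots.1 hy
    exact ((charSum_strictMonoOn d).injOn hx.1.le hy.le (hx1.trans hy1.symm)).le
  rw [xRoot, h.csInf_eq]
  exact h

theorem xRoot_pos {d : ℕ} (hd : 2 ≤ d) : 0 < xRoot d :=
  (mem_positiveRoots.1 (isLeast_xRoot hd).1).1

theorem charSum_xRoot {d : ℕ} (hd : 2 ≤ d) : charSum d (xRoot d) = 1 :=
  (mem_positiveRoots.1 (isLeast_xRoot hd).1).2

theorem rho_pos {d : ℕ} (hd : 2 ≤ d) : 0 < rho d :=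
  one_div_pos.2 (xRoot_pos hd)

theorem rho_lt_of_charSum_lt {d : ℕ} (hd : 2 ≤ d) {y : ℝ} (hy : 0 < y) (h : charSum d y⁻¹ < 1) :
    rho d < y := by
  rw [← charSum_xRoot hd, (charSum_strictMonoOn d).lt_iff_lt (inv_pos.2 hy).le
    (xRoot_pos hd).le] at h
  rw [rho, one_div]
  exact inv_lt_of_inv_lt₀ hy h

theorem lt_rho_of_lt_charSum {d : ℕ} (hd : 2 ≤ d) {y : ℝ} (hy : 0 < y) (h : 1 < charSum d y⁻¹) :
    y < rho d := by
  rw [← charSum_xRoot hd, (charSum_strictMonoOn d).lt_iff_lt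
    (xRoot_pos hd).le (inv_pos.2 hy).le] at h
  rw [rho, one_div]
  exact lt_inv_of_lt_inv₀ (xRoot_pos hd) h

theorem one_lt_rho {d : ℕ} (hd : 2 ≤ d) : 1 < rho d :=
  lt_rho_of_lt_charSum hd one_pos (by rw [inv_one]; exact one_lt_charSum_one hd)

theorem rho_pow_eq {d : ℕ} (hd : 2 ≤ d) {k : ℕ} (hk : d < k) :
    rho d ^ k = rho d ^ (k - 1) + ∑ i ∈ Finset.Icc (d / 2 + 2) d, rho d ^ (k - i) +
      ∑ i ∈ Finset.Icc ((d + 1) / 2 + 1) d, rho d ^ (k - i) := by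
  have hx : rho d * xRoot d = 1 := one_div_mul_cancel (xRoot_pos hd).ne'
  have h : ∀ i ≤ d, rho d ^ (k - i) = rho d ^ k * xRoot d ^ i := by
    intro i hi
    rw [← Nat.sub_add_cancel (show i ≤ k by omega), pow_add, mul_assoc, ← mul_pow, hx, one_pow,
      mul_one, Nat.sub_add_cancel (show i ≤ k by omega)]
  have hs (m : ℕ) : ∑ i ∈ Finset.Icc m d, rho d ^ (k - i) =
      rho d ^ k * ∑ i ∈ Finset.Icc m d, xRoot d ^ i := by
    rw [Finset.mul_sum]
    exact Finset.sum_congr rfl fun i hi => h i (Finset.mem_Icc.1 hi).2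
  rw [hs, hs, h 1 (by omega), pow_one, ← mul_add, ← mul_add]
  exact (mul_one _).symm.trans (congrArg _ (charSum_xRoot hd).symm)

/-! ### Exponential growth of `L_d(k)` -/

theorem exists_le_lambdaSize {d : ℕ} (hd : 2 ≤ d) :
    ∃ B : ℝ, 0 < B ∧ ∀ k, B * rho d ^ k ≤ lambdaSize d k := by
  have hρ := rho_pos hd
  refine ⟨(rho d ^ d)⁻¹, by positivity, fun k => ?_⟩
  induction k using Nat.strong_induction_on with
  | _ k ih =>
    by_cases hk : k ≤ d
    · have h1 : (1 : ℝ) ≤ lambdaSize d k := by exact_mod_cast one_le_lambdaSize d k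
      refine le_trans ?_ h1
      rw [inv_mul_le_one₀ (by positivity)]
      exact pow_le_pow_right₀ (one_lt_rho hd).le hk
    · have hs (m : ℕ) (hm : 1 ≤ m) : ∑ i ∈ Finset.Icc m d, (rho d ^ d)⁻¹ * rho d ^ (k - i) ≤
          ∑ i ∈ Finset.Icc m d, (lambdaSize d (k - i) : ℝ) :=
        Finset.sum_le_sum fun i hi => ih _ (by rw [Finset.mem_Icc] at hi; omega)
      rw [rho_pow_eq hd (show d < k by omega), lambdaSize_eq hd (by omega), mul_add, mul_add, Finset.mul_sum,
        Finset.mul_sum]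
      push_cast
      linarith [ih (k - 1) (by omega), hs (d / 2 + 2) (by omega), hs ((d + 1) / 2 + 1) (by omega)]

theorem exists_lambdaSize_le {d : ℕ} (hd : 2 ≤ d) :
    ∃ A : ℝ, 0 < A ∧ ∀ k, (lambdaSize d k : ℝ) ≤ A * rho d ^ k := by
  have hρ := rho_pos hd
  set A : ℝ := ∑ k ∈ Finset.range (d + 1), ((lambdaSize d k : ℝ) + 1) with hA
  have hle : ∀ k ≤ d, (lambdaSize d k : ℝ) + 1 ≤ A := fun k hk =>
    Finset.single_le_sum (f := fun k => (lambdaSize d k : ℝ) + 1) (fun i _ => by positivity)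
      (Finset.mem_range.2 (by omega))
  have hApos : 0 < A := lt_of_lt_of_le (by positivity) (hle 0 (by omega))
  -- The added `1` absorbs the inhomogeneous term of the recurrence, which has at least two summands
  -- on its right.
  have key : ∀ k, (lambdaSize d k : ℝ) + 1 ≤ A * rho d ^ k := by
    intro k
    induction k using Nat.strong_induction_on with
    | _ k ih =>
      by_cases hk : k ≤ d
      · exact (hle k hk).trans (le_mul_of_one_le_right hApos.le (one_le_pow₀ (one_lt_rho hd).le))
      · have hs (m : ℕ) (hm : 1 ≤ m) :
            ∑ i ∈ Finset.Icc m d, (lambdaSize d (k - i) : ℝ) + (d + 1 - m : ℕ) ≤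
              ∑ i ∈ Finset.Icc m d, A * rho d ^ (k - i) := by
          have : ∑ i ∈ Finset.Icc m d, ((lambdaSize d (k - i) : ℝ) + 1) ≤
              ∑ i ∈ Finset.Icc m d, A * rho d ^ (k - i) :=
            Finset.sum_le_sum fun i hi => ih _ (by rw [Finset.mem_Icc] at hi; omega)
          simpa [Finset.sum_add_distrib] using this
        have hcard : (1 : ℝ) ≤ (d + 1 - ((d + 1) / 2 + 1) : ℕ) := by
          exact_mod_cast (by omega : 1 ≤ d + 1 - ((d + 1) / 2 + 1))
        have h0 : (0 : ℝ) ≤ (d + 1 - (d / 2 + 2) : ℕ) := Nat.cast_nonneg _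
        rw [rho_pow_eq hd (show d < k by omega), lambdaSize_eq hd (by omega), mul_add, mul_add, Finset.mul_sum,
          Finset.mul_sum]
        have h1 := ih (k - 1) (by omega)
        have h2 := hs (d / 2 + 2) (by omega)
        have h3 := hs ((d + 1) / 2 + 1) (by omega)
        simp only [Nat.cast_add, Nat.cast_one, Nat.cast_sum]
        linarith
  exact ⟨A, hApos, fun k => (le_add_of_nonneg_right zero_le_one).trans (key k)⟩

theorem tendsto_mul_pow_rpow_inv {A r : ℝ} (hA : 0 < A) (hr : 0 < r) :
    Tendsto (fun k : ℕ => (A * r ^ k) ^ (k : ℝ)⁻¹) atTop (𝓝 r) := by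
  have h : Tendsto (fun k : ℕ => A ^ (k : ℝ)⁻¹ * r) atTop (𝓝 (A ^ (0 : ℝ) * r)) :=
    (tendsto_const_nhds.rpow tendsto_inv_atTop_nhds_zero_nat (Or.inl hA.ne')).mul_const r
  rw [Real.rpow_zero, one_mul] at h
  refine h.congr' ?_
  filter_upwards [eventually_ne_atTop 0] with k hk
  rw [Real.mul_rpow hA.le (by positivity), Real.pow_rpow_inv_natCast hr.le hk]

theorem tendsto_lambdaSize_rpow_inv {d : ℕ} (hd : 2 ≤ d) :
    Tendsto (fun k : ℕ => (lambdaSize d k : ℝ) ^ (k : ℝ)⁻¹) atTop (𝓝 (rho d)) := by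
  have hρ := rho_pos hd
  obtain ⟨B, hB, hBle⟩ := exists_le_lambdaSize hd
  obtain ⟨A, hA, hAle⟩ := exists_lambdaSize_le hd
  exact tendsto_of_tendsto_of_tendsto_of_le_of_le (tendsto_mul_pow_rpow_inv hB hρ)
    (tendsto_mul_pow_rpow_inv hA hρ)
    (fun k => Real.rpow_le_rpow (by positivity) (hBle k) (by positivity))
    (fun k => Real.rpow_le_rpow (by positivity) (hAle k) (by positivity))

/-! ### Asymptotics of `ρ_d` -/

theorem sum_Icc_inv_pow_mul {y : ℝ} (hy : 0 < y) (n : ℕ) {d : ℕ} (h : n ≤ d) :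
    (∑ i ∈ Finset.Icc (n + 1) d, y⁻¹ ^ i) * (y - 1) = y⁻¹ ^ n - y⁻¹ ^ d := by
  induction d, h using Nat.le_induction with
  | base => simp
  | succ d h ih =>
    rw [Finset.sum_Icc_succ_top (by omega), add_mul, ih, pow_succ]
    field_simp
    ring

theorem charSum_inv_sub_one_mul {d : ℕ} (hd : 2 ≤ d) {y : ℝ} (hy : 0 < y) :
    (charSum d y⁻¹ - 1) * (y - 1) =
      y⁻¹ ^ (d / 2 + 1) + y⁻¹ ^ ((d + 1) / 2) - 2 * y⁻¹ ^ d - (y - 1) ^ 2 / y := by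
  have h1 := sum_Icc_inv_pow_mul hy (d / 2 + 1) (d := d) (by omega)
  have h2 := sum_Icc_inv_pow_mul hy ((d + 1) / 2) (d := d) (by omega)
  have h3 : (y⁻¹ - 1) * (y - 1) = -((y - 1) ^ 2 / y) := by
    field_simp
    ring
  rw [charSum]
  linear_combination h1 + h2 + h3

theorem inv_pow_eq_rpow {y : ℝ} (hy : 0 < y) (n : ℕ) : y⁻¹ ^ n = y ^ (-n : ℝ) := by
  rw [Real.rpow_neg hy.le, Real.rpow_natCast, inv_pow]

theorem rho_lt_of_two_mul_lt {d : ℕ} (hd : 2 ≤ d) {y : ℝ} (hy : 1 < y)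
    (h : 2 * (y ^ (-(d / 2) : ℝ) * y) < (y - 1) ^ 2) : rho d < y := by
  have hy0 : 0 < y := by linarith
  have hle (n : ℕ) (hn : d ≤ 2 * n) : y⁻¹ ^ n ≤ y ^ (-(d / 2) : ℝ) := by
    rw [inv_pow_eq_rpow hy0]
    have : (d : ℝ) ≤ 2 * n := by exact_mod_cast hn
    exact Real.rpow_le_rpow_of_exponent_le hy.le (by linarith)
  refine rho_lt_of_charSum_lt hd hy0 ?_
  have h1 := charSum_inv_sub_one_mul hd hy0
  have h2 : 2 * y ^ (-(d / 2) : ℝ) < (y - 1) ^ 2 / y := by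
    rw [lt_div_iff₀ hy0]
    linarith
  have h3 : 0 < y⁻¹ ^ d := by positivity
  have h4 := hle (d / 2 + 1) (by omega)
  have h5 := hle ((d + 1) / 2) (by omega)
  by_contra! hcon
  have := mul_nonneg (sub_nonneg.2 hcon) (sub_pos.2 hy).le
  linarith

/-- Both rounded exponents are at most `d / 2 + 1`, which costs a factor `y`; the term `y⁻¹ ^ d` is
the square of `y ^ (-d / 2)`. -/
theorem lt_rho_of_lt_two_mul {d : ℕ} (hd : 2 ≤ d) {y : ℝ} (hy : 1 < y)
    (h : (y - 1) ^ 2 < 2 * (y ^ (-(d / 2) : ℝ) * (1 - y ^ (-(d / 2) : ℝ) * y))) : y < rho d := by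
  have hy0 : 0 < y := by linarith
  have hle (n : ℕ) (hn : 2 * n ≤ d + 2) : y ^ (-(d / 2) : ℝ) / y ≤ y⁻¹ ^ n := by
    rw [inv_pow_eq_rpow hy0, ← Real.rpow_sub_one hy0.ne']
    have : 2 * (n : ℝ) ≤ d + 2 := by exact_mod_cast hn
    exact Real.rpow_le_rpow_of_exponent_le hy.le (by linarith)
  refine lt_rho_of_lt_charSum hd hy0 ?_
  have h1 := charSum_inv_sub_one_mul hd hy0
  have h2 : (y - 1) ^ 2 / y < 2 * (y ^ (-(d / 2) : ℝ) / y) - 2 * y⁻¹ ^ d := by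
    have : y⁻¹ ^ d = y ^ (-(d / 2) : ℝ) * y ^ (-(d / 2) : ℝ) := by
      rw [inv_pow_eq_rpow hy0, ← Real.rpow_add hy0]
      congr 1
      ring
    rw [this, div_lt_iff₀ hy0]
    field_simp
    linarith
  have h4 := hle (d / 2 + 1) (by omega)
  have h5 := hle ((d + 1) / 2) (by omega)
  by_contra! hcon
  have := mul_nonneg (sub_nonneg.2 hcon) (sub_pos.2 hy).le
  linarith

/-- A bound for `(1 + δ) ^ (-d / 2)` in both directions. -/
theorem one_add_rpow_bounds {d δ : ℝ} (hd : 0 ≤ d) (hδ : 0 ≤ δ) (h : d * δ ^ 2 ≤ 4) :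
    Real.exp (-(d * δ / 2)) ≤ (1 + δ) ^ (-(d / 2)) ∧
      (1 + δ) ^ (-(d / 2)) ≤ Real.exp (1 - d * δ / 2) := by
  rw [Real.rpow_def_of_pos (by linarith)]
  constructor
  · have : Real.log (1 + δ) ≤ δ := by
      linarith [Real.log_le_sub_one_of_pos (show 0 < 1 + δ by linarith)]
    exact Real.exp_le_exp.2 (by nlinarith)
  -- The quadratic error contributes `d * δ ^ 2 / 4 ≤ 1` to the exponent.
  · have h1 : δ - δ ^ 2 / 2 ≤ Real.log (1 + δ) := by
      refine le_trans ?_ (Real.le_log_one_add_of_nonneg hδ)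
      rw [le_div_iff₀ (by linarith)]
      nlinarith [pow_nonneg hδ 3]
    exact Real.exp_le_exp.2 (by nlinarith)

/-- At the two test points `(y - 1)²` lies between `4 L² / d²` and `16 L² / d²`, while `y ^ (-d /
2)` is `L² / d²` times `exp (± 2 η M)` up to a factor `e`. Since `η M ≥ 8`, that exponential decides
the comparison. -/
theorem rho_bounds {d : ℕ} (hd : 2 ≤ d) {η L M : ℝ} (hL : L = Real.log d) (hM : M = Real.log L)
    (hη0 : 0 < η) (hη : η ≤ 1) (h1 : 8 ≤ η * M) (h2 : M ≤ L / 4) (h3 : 4 * L ^ 2 ≤ d)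
    (h4 : 3 ≤ L) :
    1 + 4 * (L - (1 + η) * M) / d < rho d ∧ rho d < 1 + 4 * (L - (1 - η) * M) / d := by
  have hd0 : (0 : ℝ) < d := by positivity
  have hM0 : 0 < M := by nlinarith
  have hηM : η * M ≤ M := mul_le_of_le_one_left hM0.le hη
  have hexpL : Real.exp L = d := by rw [hL, Real.exp_log hd0]
  have hexpM : Real.exp M = L := by rw [hM, Real.exp_log (by linarith)]
  have hexp (t : ℝ) : Real.exp (-(2 * L) + 2 * M + t) = L ^ 2 / (d : ℝ) ^ 2 * Real.exp t := by
    rw [Real.exp_add, Real.exp_add, Real.exp_neg, two_mul, two_mul, Real.exp_add, Real.exp_add,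
      hexpL, hexpM]
    field_simp
  have hbase (z : ℝ) (hz1 : L / 2 ≤ z) (hz2 : z ≤ L) :
      0 < 4 * z / d ∧ 4 * z / d ≤ 1 ∧ d * (4 * z / d) / 2 = 2 * z ∧
      4 * (L ^ 2 / (d : ℝ) ^ 2) ≤ (4 * z / d) ^ 2 ∧ (4 * z / d) ^ 2 ≤ 16 * (L ^ 2 / (d : ℝ) ^ 2) ∧
      d * (4 * z / d) ^ 2 ≤ 4 := by
    have hz : 0 < z := by linarith
    have hsq : (4 * z / d) ^ 2 = 16 * z ^ 2 / (d : ℝ) ^ 2 := by rw [div_pow]; ring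
    refine ⟨by positivity, ?_, by field_simp; ring, ?_, ?_, ?_⟩
    · rw [div_le_one hd0]; nlinarith
    · rw [hsq, ← mul_div_assoc]
      exact div_le_div_of_nonneg_right (by nlinarith) (by positivity)
    · rw [hsq, ← mul_div_assoc]; gcongr
    · rw [hsq, show (d : ℝ) * (16 * z ^ 2 / (d : ℝ) ^ 2) = 16 * z ^ 2 / d by field_simp,
        div_le_iff₀ hd0]
      nlinarith
  have hLd : 0 < L ^ 2 / (d : ℝ) ^ 2 := by
    have : 0 < L := by linarith
    positivity
  constructor
  · obtain ⟨b1, b2, b3, -, b5, b6⟩ := hbase (L - (1 + η) * M) (by linarith) (by nlinarith)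
    set δ := 4 * (L - (1 + η) * M) / d
    obtain ⟨c1, c2⟩ := one_add_rpow_bounds hd0.le b1.le b6
    refine lt_rho_of_lt_two_mul hd (by linarith) ?_
    set u := (1 + δ) ^ (-(d / 2) : ℝ)
    have hu0 : 0 < u := lt_of_lt_of_le (Real.exp_pos _) c1
    have hu : u ≤ 1 / 4 := by
      refine c2.trans ((Real.exp_le_exp.2 (show 1 - d * δ / 2 ≤ -2 by rw [b3]; nlinarith)).trans ?_)
      rw [Real.exp_neg, one_div]
      refine inv_anti₀ (by norm_num) ?_
      have := Real.add_one_le_exp (1 : ℝ)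
      rw [show (2 : ℝ) = 1 + 1 by norm_num, Real.exp_add]
      nlinarith
    rw [b3, show -(2 * (L - (1 + η) * M)) = -(2 * L) + 2 * M + 2 * (η * M) by ring, hexp] at c1
    -- Any constant above the `16` bounding `δ ^ 2` would do.
    have h17 : 17 ≤ Real.exp (2 * (η * M)) := by linarith [Real.add_one_le_exp (2 * (η * M))]
    have h5 : L ^ 2 / (d : ℝ) ^ 2 * 17 ≤ u := (mul_le_mul_of_nonneg_left h17 hLd.le).trans c1
    have h6 : u * (1 / 2) ≤ u * (1 - u * (1 + δ)) :=
      mul_le_mul_of_nonneg_left (by nlinarith) hu0.le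
    rw [add_sub_cancel_left]
    linarith
  · obtain ⟨b1, b2, b3, b4, -, b6⟩ := hbase (L - (1 - η) * M) (by nlinarith) (by nlinarith)
    set δ := 4 * (L - (1 - η) * M) / d
    obtain ⟨-, c2⟩ := one_add_rpow_bounds hd0.le b1.le b6
    refine rho_lt_of_two_mul_lt hd (by linarith) ?_
    set u := (1 + δ) ^ (-(d / 2) : ℝ)
    have hu0 : 0 < u := Real.rpow_pos_of_pos (by linarith) _
    rw [b3, show 1 - 2 * (L - (1 - η) * M) = -(2 * L) + 2 * M + (1 - 2 * (η * M)) by ring,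
      hexp] at c2
    have h5 : Real.exp (1 - 2 * (η * M)) < 1 := by rw [Real.exp_lt_one_iff]; linarith
    have h6 : u < L ^ 2 / (d : ℝ) ^ 2 := c2.trans_lt (mul_lt_of_lt_one_right hLd h5)
    rw [add_sub_cancel_left]
    nlinarith

theorem rho_expansion :
    (fun d : ℕ => rho d -
        (1 + 4 * Real.log d / d - 4 * Real.log (Real.log d) / d))
      =o[atTop] (fun d : ℕ => Real.log (Real.log d) / d) := by
  rw [isLittleO_iff]
  intro c hc
  -- The bounds deviate from the main terms by `4 η M / d`, to be at most `c M / d`.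
  set η := min 1 (c / 4)
  have hη0 : 0 < η := lt_min one_pos (by linarith)
  have hη : η ≤ 1 := min_le_left _ _
  have hηc : 4 * η ≤ c := by linarith [min_le_right 1 (c / 4)]
  have hd : Tendsto (fun d : ℕ => (d : ℝ)) atTop atTop := tendsto_natCast_atTop_atTop
  have hL : Tendsto (fun d : ℕ => Real.log d) atTop atTop := Real.tendsto_log_atTop.comp hd
  have hM := Real.tendsto_log_atTop.comp hL
  have e2 := hL.eventually (Real.isLittleO_log_id_atTop.bound (show (0 : ℝ) < 1 / 4 by norm_num))
  have e3 := hd.eventually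
    ((Real.isLittleO_pow_log_id_atTop (n := 2)).bound (show (0 : ℝ) < 1 / 4 by norm_num))
  filter_upwards [eventually_ge_atTop 2, hM.eventually_ge_atTop (8 / η), e2, e3,
    hL.eventually_ge_atTop 3] with d hd h1 h2 h3 h4
  have hd0 : (0 : ℝ) < d := by positivity
  simp only [Function.comp_apply] at h1
  rw [div_le_iff₀' hη0] at h1
  simp only [id, Real.norm_eq_abs] at h2 h3
  rw [abs_of_nonneg (show 0 ≤ Real.log d by linarith)] at h2
  rw [abs_of_pos hd0, abs_of_nonneg (by positivity)] at h3
  obtain ⟨l, u⟩ := rho_bounds hd rfl rfl hη0 hη h1 (by linarith [le_abs_self (Real.log (Real.log d))])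
    (by linarith) h4
  set L := Real.log d
  set M := Real.log L
  have hM0 : 0 < M := by nlinarith
  rw [Real.norm_eq_abs, Real.norm_of_nonneg (by positivity)]
  have key : 4 * (η * M / d) ≤ c * (M / d) := by
    rw [mul_div_assoc, ← mul_assoc]
    gcongr
  have el : 4 * (L - (1 + η) * M) / d = 4 * L / d - 4 * M / d - 4 * (η * M / d) := by ring
  have eu : 4 * (L - (1 - η) * M) / d = 4 * L / d - 4 * M / d + 4 * (η * M / d) := by ring
  rw [abs_le]
  constructor <;> linarith

theorem corollary3p4 :
    (∀ d : ℕ, 2 ≤ d →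
      IsLeast (positiveRoots d) (xRoot d) ∧
      (∀ k : ℕ, 1 ≤ k →
        IsLeast (universalSizes d k) (minUniversal d k) ∧ minUniversal d k ≤ lambdaSize d k) ∧
      ∃ ε : ℕ → ℝ, Tendsto ε atTop (𝓝 0) ∧
        ∀ k : ℕ, 1 ≤ k → (lambdaSize d k : ℝ) = (rho d + ε k) ^ k) ∧
    (fun d : ℕ => rho d -
        (1 + 4 * Real.log d / d - 4 * Real.log (Real.log d) / d))
      =o[atTop] (fun d : ℕ => Real.log (Real.log d) / d) := by
  refine ⟨fun d hd => ⟨isLeast_xRoot hd, fun k _ => ⟨isLeast_minUniversal hd k,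
    (isLeast_minUniversal hd k).2 (lambdaSize_mem_universalSizes hd k)⟩,
    -- The error is forced by taking `k`-th roots.
    fun k => (lambdaSize d k : ℝ) ^ (k : ℝ)⁻¹ - rho d, ?_, fun k hk => ?_⟩, rho_expansion⟩
  · simpa using (tendsto_lambdaSize_rpow_inv hd).sub_const (rho d)
  · rw [add_sub_cancel, Real.rpow_inv_natCast_pow (Nat.cast_nonneg _) (by omega)]
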